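/- **Setting.** A Pisot number is a real algebraic integer $\beta>1$ all of whose other Galois conjugates have modulus less than $1$. Let $\beta$ be a Pisot number (a unit or not) of degree $d+1$. Let its Galois conjugates other than $\beta$ itself be $\beta_1,\dots,\beta_r\in\mathbb R$ and $\beta_{r+1},\overline{\beta_{r+1}},\dots,\beta_{r+s},\overline{\beta_{r+s}}\in\mathbb C\setminus\mathbb R$, where $d=r+2s$. For $x\in\mathbb Q(\beta)$ let $x^{(j)}$ be the image of $x$ under the field homomorphism $\mathbb Q(\beta)\to\mathbb C$ with $\beta\mapsto\beta_j$, and put $$\Phi_\beta(x)=\big(x^{(1)},\dots,x^{(r)},\Re x^{(r+1)},\Im x^{(r+1)},\dots,\Re x^{(r+s)},\Im x^{(r+s)}\big)\in\mathbb R^d.$$ Let $T_\beta:[0,1)\to[0,1)$, $T_\beta(x)=\beta x-\lfloor\beta x\rfloor$. For $x\in\mathbb Z[\beta]\cap[0,1)$ the *integral $\beta$-tile* is $$\mathcal S_\beta(x)=\mathop{\mathrm{Li}}_{n\to\infty}\Phi_\beta\big(\beta^n\,(T_\beta^{-n}(x)\cap\mathbb Z[\beta])\big)\subseteq\mathbb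 R^d,$$ where $\mathrm{Li}_{n\to\infty}A_n$ is the lower Hausdorff limit, the set of all $t$ such that every neighbourhood of $t$ meets $A_n$ for all sufficiently large $n$. The number $\beta$ has property (F) if for every $x\in\mathbb Z[\beta^{-1}]\cap[0,1)$ there is an $n\in\mathbb N$ with $T_\beta^n(x)=0$. A family $(K_i)_{i\in I}$ of compact subsets of $\mathbb R^d$ that covers $\mathbb R^d$ and is locally finite (every open ball meets $K_i$ for only finitely many $i$) is a *weak $m$-tiling* if $\min_{t\in\mathbb R^d}\#\{i\in I: t\in K_i\}=m$ and $\bigcap_{k=1}^{m+1}\mathrm{int}(K_{i_k})=\emptyset$ for all pairwise different indices $i_1,\dots,i_{m+1}\in I$. A weak $1$-tiling is called a *weak tiling*. **Theorem.** Let $\beta$ be a Pisot number. 1. The family $\big(\mathcal S_\beta(x)\big)_{x\in\mathbb Z[\beta]\cap[0,1)}$ is a weak $m$-tiling of $\mathbb R^d$ for some integer $m\ge1$. 2. If $\beta$ has property (F), then $\big(\mathcal S_\beta(x)\big)_{x\in\mathbb Z[\beta]\cap[0,1)}$ is a weak tiling of $\mathbb R^d$. -/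

import Mathlib

open Filter Topology Set IntermediateField

/-- A Pisot number: a real algebraic integer `β > 1` all of whose other Galois conjugates have
modulus less than `1`. -/
structure IsPisot (β : ℝ) : Prop where
  one_lt : 1 < β
  isIntegral : IsIntegral ℤ β
  norm_conj_lt_one : ∀ z : ℂ, Polynomial.aeval z (minpoly ℚ β) = 0 → z ≠ (β : ℂ) → ‖z‖ < 1

/-- The `β`-transformation `x ↦ {βx} = βx - ⌊βx⌋`. It maps `[0,1)` to itself, and it is only used
on `[0,1)`. -/
noncomputable def betaTransform (β : ℝ) (x : ℝ) : ℝ := Int.fract (β * x)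

/-- The finiteness property (F): for every `x ∈ ℤ[β⁻¹] ∩ [0,1)` there is `n` with
`T_β^n(x) = 0`. -/
def FinitenessProperty (β : ℝ) : Prop :=
  ∀ x : ℝ, x ∈ Algebra.adjoin ℤ {β⁻¹} → x ∈ Ico (0 : ℝ) 1 →
    ∃ n : ℕ, (betaTransform β)^[n] x = 0

/-- The set `ℤ[β] ∩ [0,1)`. -/
def integralUnitPart (β : ℝ) : Set ℝ :=
  {x | x ∈ Algebra.adjoin ℤ {β} ∧ x ∈ Ico (0 : ℝ) 1}

/-- The generator `β` of the field `ℚ(β)`, as an element of that field. -/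
noncomputable abbrev genBeta (β : ℝ) : ℚ⟮β⟯ := AdjoinSimple.gen ℚ β

/-- The conjugation maps `x ↦ x⁽ʲ⁾` of `ℚ(β)`, enumerated as `ρ₁, …, ρ_r` (real) and
`σ₁, …, σ_s` (one from each pair of complex conjugate ones): the numbers
`ρᵢ(β)`, `σⱼ(β)`, `conj (σⱼ(β))` are pairwise distinct, they are exactly the Galois
conjugates of `β` other than `β` itself, and the numbers `σⱼ(β)` are not real. -/
structure IsConjugateSystem (β : ℝ) {r s : ℕ}
    (ρ : Fin r → (ℚ⟮β⟯ →+* ℝ)) (σ : Fin s → (ℚ⟮β⟯ →+* ℂ)) : Prop where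
  bijOn : BijOn
    (Sum.elim (fun i : Fin r => ((ρ i (genBeta β) : ℝ) : ℂ))
      (Sum.elim (fun j : Fin s => σ j (genBeta β))
        (fun j : Fin s => (starRingEnd ℂ) (σ j (genBeta β)))))
    univ {z : ℂ | Polynomial.aeval z (minpoly ℚ β) = 0 ∧ z ≠ (β : ℂ)}
  im_ne_zero : ∀ j, (σ j (genBeta β)).im ≠ 0

/-- Euclidean space of dimension `r + 2s`: one coordinate for each `i : Fin r`, and a pair of
coordinates for each `j : Fin s`. -/
abbrev ConjSpace (r s : ℕ) : Type := EuclideanSpace ℝ (Fin r ⊕ Fin s × Fin 2)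

/-- The map `Φ_β : ℚ(β) → ℝ^d`, `d = r + 2s`, sending `x` to
`(x⁽¹⁾, …, x⁽ʳ⁾, Re x⁽ʳ⁺¹⁾, Im x⁽ʳ⁺¹⁾, …, Re x⁽ʳ⁺ˢ⁾, Im x⁽ʳ⁺ˢ⁾)`. -/
noncomputable def conjEmbedding {β : ℝ} {r s : ℕ}
    (ρ : Fin r → (ℚ⟮β⟯ →+* ℝ)) (σ : Fin s → (ℚ⟮β⟯ →+* ℂ)) (x : ℚ⟮β⟯) : ConjSpace r s :=
  WithLp.toLp 2 (Sum.elim (fun i => ρ i x) (fun p => ![(σ p.1 x).re, (σ p.1 x).im] p.2))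

/-- The lower Hausdorff (Kuratowski) limit of a sequence of sets: all points `t` such that each
neighbourhood of `t` meets `A n` for all sufficiently large `n`. -/
def lowerLimit {X : Type*} [TopologicalSpace X] (A : ℕ → Set X) : Set X :=
  {t | ∀ U ∈ 𝓝 t, ∀ᶠ n in atTop, (A n ∩ U).Nonempty}

/-- The set `β^n (T_β^{-n}(x) ∩ ℤ[β])` as a subset of `ℚ(β)`; here `T_β^{-n}(x)` is the set of
those `u ∈ [0,1)` with `T_β^n(u) = x`. -/
def scaledPreimage (β : ℝ) (x : ℝ) (n : ℕ) : Set ℚ⟮β⟯ :=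
  {y | ∃ u ∈ integralUnitPart β, (betaTransform β)^[n] u = x ∧ (y : ℝ) = β ^ n * u}

/-- The integral `β`-tile `S_β(x)`, the lower Hausdorff limit of
`Φ_β(β^n (T_β^{-n}(x) ∩ ℤ[β]))` as `n → ∞`. -/
noncomputable def integralBetaTile {β : ℝ} {r s : ℕ}
    (ρ : Fin r → (ℚ⟮β⟯ →+* ℝ)) (σ : Fin s → (ℚ⟮β⟯ →+* ℂ)) (x : ℝ) : Set (ConjSpace r s) :=
  lowerLimit fun n => conjEmbedding ρ σ '' scaledPreimage β x n

/-- The covering degree of a point `t` with respect to the family `K`: the number of members of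
the family that contain `t`. -/
noncomputable def coveringDegree {ι X : Type*} (K : ι → Set X) (t : X) : ℕ∞ :=
  {i | t ∈ K i}.encard

/-- A weak `m`-tiling: a locally finite family of compact sets covering the space, whose covering
degree (the minimum over all points `t` of the covering degree of `t`) is `m`, and such that the
interiors of any `m + 1` different members have empty intersection. -/
structure IsWeakMTiling {ι X : Type*} [MetricSpace X] (K : ι → Set X) (m : ℕ) : Prop where
  isCompact : ∀ i, IsCompact (K i)
  locallyFinite : ∀ (t : X) (ε : ℝ), {i | (K i ∩ Metric.ball t ε).Nonempty}.Finite
  covers : ⋃ i, K i = univ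
  degree : IsLeast (range (coveringDegree K)) (m : ℕ∞)
  interiors : ∀ F : Finset ι, F.card = m + 1 → ⋂ i ∈ F, interior (K i) = ∅

/-!
The conjugate embedding is viewed as a ring homomorphism `Φ` from `ℤ[β]` to the normed ring `ℝ ^ r
× ℂ ^ s`, in which multiplication by `Φ β` is an invertible contraction. The sets `X n x = β ^ n
(T_β^{-n}(x) ∩ ℤ[β])` and `X (n + 1) x` differ, after applying `Φ`, by at most a digit times `Φ β
^ n`: in one direction because `T_β` maps `ℤ[β] ∩ [0,1)` to itself, in the other because each of
its points has a preimage there. The latter holds for non-units too, as the norm of `β` is at most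
`β` in modulus, so that there are enough digits to reach every residue class modulo `β`
(`IsPisot.exists_preimage`). Hence the sets `Φ (X n x)` converge exponentially fast, and the lower
limit that defines a tile agrees with the upper limit
(`IsTilingEmbedding.mem_ringTile_of_frequently`). As `ℤ[β]` is a lattice in Minkowski space, only
finitely many tiles meet a given ball, and a pigeonhole argument gives the covering property and
the subdivision of `S_β(x)` into the sets `β ^ k S_β(z)` with `T_β^k(z) = x`
(`IsTilingEmbedding.exists_mem_ringTile_of_pow_mul`).

Let `m` be the least covering degree, attained at `t₀`. If `v ∈ β ^ n ℤ[β]` is nonnegative and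
small enough as a real number, then the tiles near `t₀ + Φ v` are, up to stage `n`, translates of
those near `t₀`; so, for `n` large, the covering degree at `t₀ + Φ v` is at most `m`. These points
are relatively dense (`IsTilingEmbedding.exists_encard_le_near`). A ball contained in `m + 1`
tiles would, by subdivision and blowing up, yield arbitrarily large balls all of whose points have
covering degree at least `m + 1`, which is impossible
(`IsTilingEmbedding.iInter_interior_eq_empty`).

If the origin lies in `S_β(x)`, then subdividing `n` times yields one of the finitely many `z`
with `0 ∈ S_β(z)` such that `T_β^n(z) = x`; under property (F) this forces `x = 0` for large `n`.
So the origin has covering degree `1` (`IsTilingEmbedding.eq_zero_of_zero_mem_ringTile`).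
-/

/-! ### The ring `ℤ[β]` and the `β`-transformation on it -/

/-- The ring `ℤ[β]` as a subalgebra of `ℝ`. -/
abbrev betaRing (β : ℝ) : Subalgebra ℤ ℝ := Algebra.adjoin ℤ {β}

/-- The generator `β` of `ℤ[β]`, as an element of that ring. -/
def betaGen (β : ℝ) : betaRing β := ⟨β, Algebra.subset_adjoin rfl⟩

/-- The part of `ℤ[β]` that lies in `[0,1)`, as a set of elements of `ℤ[β]`. -/
def betaUnit (β : ℝ) : Set (betaRing β) := {u | 0 ≤ (u : ℝ) ∧ (u : ℝ) < 1}

/-- The `β`-transformation as a self-map of `ℤ[β]`. -/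
noncomputable def betaStep (β : ℝ) (u : betaRing β) : betaRing β :=
  betaGen β * u - (⌊β * (u : ℝ)⌋ : ℤ)

section Dynamics

variable {β : ℝ}

@[simp] lemma coe_betaGen : ((betaGen β : betaRing β) : ℝ) = β := rfl

lemma coe_betaStep (u : betaRing β) : ((betaStep β u : betaRing β) : ℝ) = betaTransform β u := by
  push_cast [betaStep]
  rfl

lemma coe_iterate_betaStep (n : ℕ) (u : betaRing β) :
    (((betaStep β)^[n] u : betaRing β) : ℝ) = (betaTransform β)^[n] u := by
  induction n generalizing u with
  | zero => rfl
  | succ n ih => rw [Function.iterate_succ_apply, ih, coe_betaStep, ← Function.iterate_succ_apply]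

lemma betaStep_mem (u : betaRing β) : betaStep β u ∈ betaUnit β := by
  refine ⟨?_, ?_⟩ <;> rw [coe_betaStep]
  · exact Int.fract_nonneg _
  · exact Int.fract_lt_one _

lemma iterate_betaStep_mem (n : ℕ) {u : betaRing β} (hu : u ∈ betaUnit β) :
    (betaStep β)^[n] u ∈ betaUnit β := by
  cases n with
  | zero => exact hu
  | succ n => rw [Function.iterate_succ_apply']; exact betaStep_mem _

lemma betaStep_eq_of_mul_eq {u z : betaRing β} {k : ℤ} (hz : z ∈ betaUnit β)
    (h : betaGen β * u = z + k) : betaStep β u = z := by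
  have h' : β * (u : ℝ) = z + k := by simpa using congrArg (Subtype.val) h
  have hk : ⌊β * (u : ℝ)⌋ = k := by
    rw [h', Int.floor_add_intCast, Int.floor_eq_zero_iff.2 ⟨hz.1, hz.2⟩, zero_add]
  rw [betaStep, hk, h, add_sub_cancel_right]

/-- Backward orbits may be translated: if `u` reaches `z` after `n` steps and `z - β ^ n v` is
still nonnegative, then `u - v` reaches `z - β ^ n v` with the same digits. -/
lemma iterate_betaStep_sub (hβ : 0 < β) (n : ℕ) {u v : betaRing β} (hu : u ∈ betaUnit β)
    (hv : 0 ≤ (v : ℝ))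
    (h : 0 ≤ (((betaStep β)^[n] u - betaGen β ^ n * v : betaRing β) : ℝ)) :
    u - v ∈ betaUnit β ∧
      (betaStep β)^[n] (u - v) = (betaStep β)^[n] u - betaGen β ^ n * v := by
  induction n generalizing u v with
  | zero =>
    simp only [Function.iterate_zero, id, pow_zero, one_mul] at h ⊢
    refine ⟨⟨h, ?_⟩, trivial⟩
    have := hu.2
    push_cast
    linarith
  | succ n ih =>
    rw [Function.iterate_succ_apply, pow_succ, mul_assoc] at h
    obtain ⟨hm, he⟩ := ih (betaStep_mem u)
      (by simpa using mul_nonneg hβ.le hv : 0 ≤ ((betaGen β * v : betaRing β) : ℝ)) h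
    set k : ℤ := ⌊β * (u : ℝ)⌋ with hk
    have hk0 : (0 : ℝ) ≤ k := by
      exact_mod_cast Int.floor_nonneg.2 (mul_nonneg hβ.le hu.1)
    have hmul : betaGen β * (u - v) = (betaStep β u - betaGen β * v) + k := by
      rw [betaStep]; ring
    have hge : 0 ≤ ((u - v : betaRing β) : ℝ) := by
      have h1 : β * ((u - v : betaRing β) : ℝ) =
          ((betaStep β u - betaGen β * v : betaRing β) : ℝ) + k := by
        simpa using congrArg (Subtype.val) hmul
      have h2 := hm.1
      by_contra hneg
      have := mul_neg_of_pos_of_neg hβ (not_le.1 hneg)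
      linarith
    have hlt : ((u - v : betaRing β) : ℝ) < 1 := by
      have := hu.2
      push_cast
      linarith
    refine ⟨⟨hge, hlt⟩, ?_⟩
    rw [Function.iterate_succ_apply, betaStep_eq_of_mul_eq hm hmul, he, Function.iterate_succ_apply,
      pow_succ, mul_assoc]

/-- The set `β ^ n (T_β^{-n}(x) ∩ ℤ[β])` as a subset of `ℤ[β]`. -/
def ringPreimage (β : ℝ) (x : betaRing β) (n : ℕ) : Set (betaRing β) :=
  {y | ∃ u ∈ betaUnit β, (betaStep β)^[n] u = x ∧ y = betaGen β ^ n * u}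

end Dynamics

/-! ### Tiles in a normed ring -/

/-- The properties of a homomorphism `Φ` from `ℤ[β]` to a normed ring on which the tiling theorem
rests: multiplication by `β` becomes an invertible contraction, `ℤ[β]` is discrete with respect to
the real and the `Φ`-coordinate together, each point of `ℤ[β] ∩ [0,1)` has a preimage under the
`β`-transformation in that set, and the points of `β ^ n ℤ[β]` in any interval `[0,η)` have a
relatively dense image. -/
structure IsTilingEmbedding {W : Type*} [NormedCommRing W] (β : ℝ) (Φ : betaRing β →+* W) :
    Prop where
  one_lt : 1 < β
  norm_lt_one : ‖Φ (betaGen β)‖ < 1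
  isUnit : IsUnit (Φ (betaGen β))
  finite_bounded : ∀ C : ℝ, {x : betaRing β | |(x : ℝ)| ≤ C ∧ ‖Φ x‖ ≤ C}.Finite
  exists_preimage : ∀ u ∈ betaUnit β, ∃ u' ∈ betaUnit β, betaStep β u' = u
  relatively_dense : ∀ (n : ℕ) (η : ℝ), 0 < η → ∃ R : ℝ, ∀ w : W, ∃ v : betaRing β,
    0 ≤ (v : ℝ) ∧ ((betaGen β ^ n * v : betaRing β) : ℝ) < η ∧ ‖Φ (betaGen β ^ n * v) - w‖ ≤ R

/-- The tile `S_β(x)` for a general homomorphism `Φ` in place of the conjugate embedding. -/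
def ringTile {W : Type*} [NormedCommRing W] {β : ℝ} (Φ : betaRing β →+* W) (x : betaRing β) :
    Set W :=
  lowerLimit fun n => Φ '' ringPreimage β x n

lemma isClosed_lowerLimit {X : Type*} [TopologicalSpace X] (A : ℕ → Set X) :
    IsClosed (lowerLimit A) := by
  rw [← isOpen_compl_iff, isOpen_iff_mem_nhds]
  intro t ht
  simp only [lowerLimit, mem_compl_iff, mem_ofPred_eq, not_forall] at ht
  obtain ⟨U, hU, hA⟩ := ht
  filter_upwards [eventually_mem_nhds_iff.2 hU] with s hs h
  exact hA (h U hs)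

namespace IsTilingEmbedding

variable {W : Type*} [NormedCommRing W] {β : ℝ} {Φ : betaRing β →+* W}

lemma norm_map_pow_mul_le (n : ℕ) (w : W) :
    ‖Φ (betaGen β) ^ n * w‖ ≤ ‖Φ (betaGen β)‖ ^ n * ‖w‖ := by
  induction n with
  | zero => simp
  | succ n ih =>
    rw [pow_succ', mul_assoc, pow_succ', mul_assoc]
    exact (norm_mul_le _ _).trans (mul_le_mul_of_nonneg_left ih (norm_nonneg _))

variable (Φ) in
/-- A bound for the `Φ`-distance between the sets `β ^ n (T_β^{-n}(x) ∩ ℤ[β])` and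
`β ^ m (T_β^{-m}(x) ∩ ℤ[β])`, `m ≥ n`: the tail of the geometric series of the digits. -/
noncomputable def tailBound (n : ℕ) : ℝ :=
  β * ‖(1 : W)‖ * ‖Φ (betaGen β)‖ ^ n / (1 - ‖Φ (betaGen β)‖)

lemma tailBound_sub_succ (h : IsTilingEmbedding β Φ) (n : ℕ) :
    tailBound Φ n - tailBound Φ (n + 1) = β * ‖(1 : W)‖ * ‖Φ (betaGen β)‖ ^ n := by
  have := (sub_pos.2 h.norm_lt_one).ne'
  rw [tailBound, tailBound]
  field_simp
  ring

lemma tailBound_nonneg (h : IsTilingEmbedding β Φ) (n : ℕ) : 0 ≤ tailBound Φ n := by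
  have := sub_pos.2 h.norm_lt_one
  have := zero_lt_one.trans h.one_lt
  unfold tailBound
  positivity

lemma tendsto_pow (h : IsTilingEmbedding β Φ) (C : ℝ) :
    Tendsto (fun n : ℕ => ‖Φ (betaGen β)‖ ^ n * C) atTop (𝓝 0) := by
  simpa using (tendsto_pow_atTop_nhds_zero_of_lt_one (norm_nonneg _) h.norm_lt_one).mul_const C

lemma tendsto_tailBound (h : IsTilingEmbedding β Φ) : Tendsto (tailBound Φ) atTop (𝓝 0) := by
  refine (h.tendsto_pow (β * ‖(1 : W)‖ / (1 - ‖Φ (betaGen β)‖))).congr fun n => ?_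
  rw [tailBound]
  ring

/-- Passing from `β u` to `T_β u` changes the `n`-fold multiple by a digit times `β ^ n`. -/
lemma norm_map_step_le (h : IsTilingEmbedding β Φ) (n : ℕ) {u : betaRing β}
    (hu : u ∈ betaUnit β) :
    ‖Φ (betaGen β ^ (n + 1) * u) - Φ (betaGen β ^ n * betaStep β u)‖ ≤
      tailBound Φ n - tailBound Φ (n + 1) := by
  have hβ := zero_lt_one.trans h.one_lt
  obtain ⟨k, hk⟩ := Int.eq_ofNat_of_zero_le (Int.floor_nonneg.2 (mul_nonneg hβ.le hu.1))
  have hkβ : (k : ℝ) ≤ β := by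
    have h1 : (k : ℝ) ≤ β * u := by
      have := Int.floor_le (β * (u : ℝ))
      rwa [hk] at this
    nlinarith [hu.2]
  have hdiff : Φ (betaGen β ^ (n + 1) * u) - Φ (betaGen β ^ n * betaStep β u) =
      Φ (betaGen β) ^ n * (k • (1 : W)) := by
    rw [← map_sub, betaStep, hk, pow_succ]
    have : betaGen β ^ n * betaGen β * u - betaGen β ^ n * (betaGen β * u - ((k : ℤ) : betaRing β))
      = betaGen β ^ n * (k : betaRing β) := by push_cast; ring
    rw [this]
    simp
  rw [hdiff, h.tailBound_sub_succ]
  refine (norm_map_pow_mul_le _ _).trans ?_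
  rw [mul_comm]
  refine mul_le_mul_of_nonneg_right (norm_nsmul_le.trans ?_) (by positivity)
  exact mul_le_mul_of_nonneg_right hkβ (norm_nonneg _)

lemma exists_mem_of_le (h : IsTilingEmbedding β Φ) {x y : betaRing β} {n m : ℕ} (hnm : n ≤ m)
    (hy : y ∈ ringPreimage β x n) :
    ∃ y' ∈ ringPreimage β x m, ‖Φ y' - Φ y‖ ≤ tailBound Φ n - tailBound Φ m := by
  induction m, hnm using Nat.le_induction with
  | base => exact ⟨y, hy, by simp⟩
  | succ m hm ih =>
    obtain ⟨_, ⟨u, hu, hux, rfl⟩, hle⟩ := ih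
    obtain ⟨u', hu', rfl⟩ := h.exists_preimage u hu
    refine ⟨_, ⟨u', hu', hux, rfl⟩, ?_⟩
    linarith [norm_sub_le_norm_sub_add_norm_sub (Φ (betaGen β ^ (m + 1) * u'))
      (Φ (betaGen β ^ m * betaStep β u')) (Φ y), h.norm_map_step_le m hu']

lemma exists_mem_of_ge (h : IsTilingEmbedding β Φ) {x y : betaRing β} {n m : ℕ} (hnm : n ≤ m)
    (hy : y ∈ ringPreimage β x m) :
    ∃ y' ∈ ringPreimage β x n, ‖Φ y' - Φ y‖ ≤ tailBound Φ n - tailBound Φ m := by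
  induction m, hnm using Nat.le_induction generalizing y with
  | base => exact ⟨y, hy, by simp⟩
  | succ m hm ih =>
    obtain ⟨u, hu, hux, rfl⟩ := hy
    obtain ⟨y', hy', hle⟩ := ih ⟨betaStep β u, betaStep_mem u, hux, rfl⟩
    refine ⟨y', hy', ?_⟩
    have := h.norm_map_step_le m hu
    rw [norm_sub_rev] at this
    linarith [norm_sub_le_norm_sub_add_norm_sub (Φ y') (Φ (betaGen β ^ m * betaStep β u))
      (Φ (betaGen β ^ (m + 1) * u))]

lemma mem_ringPreimage_zero {x y : betaRing β} (hy : y ∈ ringPreimage β x 0) : y = x := by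
  obtain ⟨u, -, rfl, rfl⟩ := hy
  simp

lemma mem_betaUnit_of_mem_ringPreimage {x y : betaRing β} {n : ℕ}
    (hy : y ∈ ringPreimage β x n) : x ∈ betaUnit β := by
  obtain ⟨u, hu, rfl, -⟩ := hy
  exact iterate_betaStep_mem n hu

lemma norm_map_sub_le_of_mem (h : IsTilingEmbedding β Φ) {x y : betaRing β} {n : ℕ}
    (hy : y ∈ ringPreimage β x n) : ‖Φ x - Φ y‖ ≤ tailBound Φ 0 := by
  obtain ⟨y', hy', hle⟩ := h.exists_mem_of_ge (Nat.zero_le n) hy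
  rw [mem_ringPreimage_zero hy'] at hle
  linarith [h.tailBound_nonneg n]

lemma eventually_exists_of_mem_ringTile {x : betaRing β} {t : W} (ht : t ∈ ringTile Φ x) {ε : ℝ}
    (hε : 0 < ε) : ∀ᶠ n in atTop, ∃ y ∈ ringPreimage β x n, ‖Φ y - t‖ < ε := by
  filter_upwards [ht _ (Metric.ball_mem_nhds t hε)] with n hn
  obtain ⟨_, ⟨y, hy, rfl⟩, hb⟩ := hn
  exact ⟨y, hy, by rwa [← dist_eq_norm]⟩

/-- Each finite stage approximates the tile with an explicit error. -/
lemma exists_near_of_mem_ringTile (h : IsTilingEmbedding β Φ) {x : betaRing β} {t : W}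
    (ht : t ∈ ringTile Φ x) (n : ℕ) {δ : ℝ} (hδ : 0 < δ) :
    ∃ y ∈ ringPreimage β x n, ‖Φ y - t‖ < tailBound Φ n + δ := by
  obtain ⟨m, ⟨y, hy, hyt⟩, hm⟩ :=
    ((eventually_exists_of_mem_ringTile ht hδ).and (eventually_ge_atTop n)).exists
  obtain ⟨y', hy', hle⟩ := h.exists_mem_of_ge hm hy
  exact ⟨y', hy', by
    linarith [norm_sub_le_norm_sub_add_norm_sub (Φ y') (Φ y) t, h.tailBound_nonneg m]⟩

/-- The lower limit that defines a tile contains the upper limit, because the finite stages are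
Cauchy in the Hausdorff sense. -/
lemma mem_ringTile_of_frequently (h : IsTilingEmbedding β Φ) {x : betaRing β} {t : W}
    (ht : ∀ ε > 0, ∃ᶠ n in atTop, ∃ y ∈ ringPreimage β x n, ‖Φ y - t‖ < ε) :
    t ∈ ringTile Φ x := by
  intro U hU
  obtain ⟨ε, hε, hb⟩ := Metric.mem_nhds_iff.1 hU
  have hE := h.tendsto_tailBound.eventually (gt_mem_nhds (half_pos hε))
  obtain ⟨n, ⟨y, hy, hyt⟩, hn⟩ := ((ht _ (half_pos hε)).and_eventually hE).exists
  filter_upwards [eventually_ge_atTop n] with m hm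
  obtain ⟨y', hy', hle⟩ := h.exists_mem_of_le hm hy
  refine ⟨Φ y', ⟨y', hy', rfl⟩, hb ?_⟩
  rw [Metric.mem_ball, dist_eq_norm]
  linarith [norm_sub_le_norm_sub_add_norm_sub (Φ y') (Φ y) t, h.tailBound_nonneg m]

lemma eventually_le_of_notMem_ringTile (h : IsTilingEmbedding β Φ) {x : betaRing β} {t : W}
    (ht : t ∉ ringTile Φ x) :
    ∃ ε > 0, ∀ᶠ n in atTop, ∀ y ∈ ringPreimage β x n, ε ≤ ‖Φ y - t‖ := by
  by_contra! hcon
  refine ht (h.mem_ringTile_of_frequently fun ε hε => ?_)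
  simpa using hcon ε hε

lemma mem_betaUnit_of_mem_ringTile (h : IsTilingEmbedding β Φ) {x : betaRing β} {t : W}
    (ht : t ∈ ringTile Φ x) : x ∈ betaUnit β := by
  obtain ⟨y, hy, -⟩ := h.exists_near_of_mem_ringTile ht 0 one_pos
  exact mem_betaUnit_of_mem_ringPreimage hy

lemma norm_sub_le_of_mem_ringTile (h : IsTilingEmbedding β Φ) {x : betaRing β} {t : W}
    (ht : t ∈ ringTile Φ x) : ‖Φ x - t‖ ≤ tailBound Φ 0 := by
  refine le_of_forall_pos_le_add fun δ hδ => ?_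
  obtain ⟨y, hy, hle⟩ := h.exists_near_of_mem_ringTile ht 0 hδ
  rw [mem_ringPreimage_zero hy] at hle
  exact hle.le

lemma finite_near (h : IsTilingEmbedding β Φ) (t : W) (C : ℝ) :
    {x : betaRing β | |(x : ℝ)| ≤ 1 ∧ ‖Φ x - t‖ ≤ C}.Finite := by
  refine (h.finite_bounded (max 1 (C + ‖t‖))).subset fun x hx => ⟨hx.1.trans (le_max_left _ _), ?_⟩
  refine le_trans ?_ (le_max_right _ _)
  have := norm_add_le (Φ x - t) t
  rw [sub_add_cancel] at this
  linarith [hx.2]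

lemma abs_le_one_of_mem_betaUnit {x : betaRing β} (hx : x ∈ betaUnit β) : |(x : ℝ)| ≤ 1 := by
  rw [abs_of_nonneg hx.1]; exact hx.2.le

lemma finite_meeting_ball (h : IsTilingEmbedding β Φ) (t : W) (ε : ℝ) :
    {x : betaRing β | (ringTile Φ x ∩ Metric.ball t ε).Nonempty}.Finite := by
  refine (h.finite_near t (tailBound Φ 0 + ε)).subset ?_
  rintro x ⟨p, hp, hpt⟩
  refine ⟨abs_le_one_of_mem_betaUnit (h.mem_betaUnit_of_mem_ringTile hp), ?_⟩
  rw [Metric.mem_ball, dist_eq_norm] at hpt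
  linarith [norm_sub_le_norm_sub_add_norm_sub (Φ x) p t, h.norm_sub_le_of_mem_ringTile hp]

lemma finite_containing (h : IsTilingEmbedding β Φ) (t : W) :
    {x : betaRing β | t ∈ ringTile Φ x}.Finite :=
  (h.finite_meeting_ball t 1).subset fun _ hx => ⟨t, hx, Metric.mem_ball_self one_pos⟩

lemma isCompact_ringTile [ProperSpace W] (h : IsTilingEmbedding β Φ) (x : betaRing β) :
    IsCompact (ringTile Φ x) := by
  refine (isCompact_closedBall (Φ x) (tailBound Φ 0)).of_isClosed_subset (isClosed_lowerLimit _)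
    fun t ht => ?_
  rw [Metric.mem_closedBall, dist_comm, dist_eq_norm]
  exact h.norm_sub_le_of_mem_ringTile ht

/-- Only finitely many tiles come near a point, so a point approximated at every stage by some
tile with property `P` lies in one of these tiles. -/
lemma exists_mem_ringTile (h : IsTilingEmbedding β Φ) {p : W} {P : betaRing β → Prop}
    (hp : ∀ ε > 0, ∀ᶠ n in atTop, ∃ z, P z ∧ ∃ y ∈ ringPreimage β z n, ‖Φ y - p‖ < ε) :
    ∃ z, P z ∧ p ∈ ringTile Φ z := by
  by_contra! hcon
  have hF := h.finite_near p (tailBound Φ 0 + 1)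
  have hsmall : ∀ᶠ ε in 𝓝[>] (0 : ℝ), ∀ z ∈ {x : betaRing β | |(x : ℝ)| ≤ 1 ∧
      ‖Φ x - p‖ ≤ tailBound Φ 0 + 1}, P z →
      ∀ᶠ n in atTop, ∀ y ∈ ringPreimage β z n, ε ≤ ‖Φ y - p‖ := by
    refine (eventually_all_finite hF).2 fun z _ => ?_
    by_cases hz : P z
    · obtain ⟨ε, hε, he⟩ := h.eventually_le_of_notMem_ringTile (hcon z hz)
      filter_upwards [Ioo_mem_nhdsGT hε] with ε' hε' _
      filter_upwards [he] with n hn y hy using hε'.2.le.trans (hn y hy)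
    · exact Eventually.of_forall fun _ h' => absurd h' hz
  obtain ⟨ε, hε, hε0, hε1⟩ := (hsmall.and (Ioo_mem_nhdsGT one_pos)).exists
  have hall : ∀ᶠ n in atTop, ∀ z ∈ {x : betaRing β | |(x : ℝ)| ≤ 1 ∧
      ‖Φ x - p‖ ≤ tailBound Φ 0 + 1}, P z → ∀ y ∈ ringPreimage β z n, ε ≤ ‖Φ y - p‖ := by
    refine (eventually_all_finite hF).2 fun z hz => ?_
    by_cases hPz : P z
    · filter_upwards [hε z hz hPz] with n hn _ using hn
    · exact Eventually.of_forall fun _ h' => absurd h' hPz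
  obtain ⟨n, hn, z, hPz, y, hy, hlt⟩ := (hall.and (hp ε hε0)).exists
  refine absurd hlt (not_lt.2 (hn z ⟨?_, ?_⟩ hPz y hy))
  · exact abs_le_one_of_mem_betaUnit (mem_betaUnit_of_mem_ringPreimage hy)
  · linarith [norm_sub_le_norm_sub_add_norm_sub (Φ z) (Φ y) p, h.norm_map_sub_le_of_mem hy]

lemma exists_pow_mul_eq (h : IsTilingEmbedding β Φ) (k : ℕ) (t : W) :
    ∃ w, Φ (betaGen β) ^ k * w = t := by
  obtain ⟨c, hc⟩ := (h.isUnit.pow k).exists_right_inv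
  exact ⟨c * t, by rw [← mul_assoc, hc, one_mul]⟩

/-- The tiles cover the whole space. -/
lemma exists_mem_ringTile_cover (h : IsTilingEmbedding β Φ) (t : W) :
    ∃ z, t ∈ ringTile Φ z := by
  obtain ⟨R, hR⟩ := h.relatively_dense 0 1 one_pos
  obtain ⟨z, -, hz⟩ := h.exists_mem_ringTile (p := t) (P := fun _ => True) fun ε hε => by
    filter_upwards [(h.tendsto_pow R).eventually (gt_mem_nhds hε)] with n hn
    obtain ⟨w, rfl⟩ := h.exists_pow_mul_eq n t
    obtain ⟨v, hv0, hv1, hv⟩ := hR w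
    rw [pow_zero, one_mul] at hv1 hv
    refine ⟨(betaStep β)^[n] v, trivial, betaGen β ^ n * v, ⟨v, ⟨hv0, hv1⟩, rfl, rfl⟩, ?_⟩
    rw [map_mul, map_pow, ← mul_sub]
    exact (norm_map_pow_mul_le _ _).trans_lt
      ((mul_le_mul_of_nonneg_left hv (by positivity)).trans_lt hn)
  exact ⟨z, hz⟩

/-- Subdivision of a tile: `S_β(x)` is contained in the union of the sets `β ^ k S_β(z)` over
the points `z` with `T_β^k(z) = x`. -/
lemma exists_mem_ringTile_of_pow_mul (h : IsTilingEmbedding β Φ) (k : ℕ) {x : betaRing β} {p : W}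
    (hp : Φ (betaGen β) ^ k * p ∈ ringTile Φ x) :
    ∃ z, (betaStep β)^[k] z = x ∧ p ∈ ringTile Φ z := by
  obtain ⟨c, hc⟩ := (h.isUnit.pow k).exists_left_inv
  refine h.exists_mem_ringTile fun ε hε => ?_
  have hc1 : 0 < ‖c‖ + 1 := by positivity
  have := (tendsto_add_atTop_nat k).eventually
    (eventually_exists_of_mem_ringTile hp (div_pos hε hc1))
  filter_upwards [this] with n hn
  obtain ⟨_, ⟨u, hu, hux, rfl⟩, hlt⟩ := hn
  refine ⟨(betaStep β)^[n] u, ?_, betaGen β ^ n * u, ⟨u, hu, rfl, rfl⟩, ?_⟩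
  · rw [← Function.iterate_add_apply, add_comm, hux]
  · have heq : Φ (betaGen β ^ n * u) - p =
        c * (Φ (betaGen β ^ (n + k) * u) - Φ (betaGen β) ^ k * p) := by
      have : Φ (betaGen β ^ (n + k) * u) = Φ (betaGen β) ^ k * Φ (betaGen β ^ n * u) := by
        simp only [map_mul, map_pow]; ring
      rw [this, ← mul_sub, ← mul_assoc, hc, one_mul]
    rw [heq]
    refine (norm_mul_le _ _).trans_lt ?_
    rw [lt_div_iff₀ hc1] at hlt
    nlinarith [norm_nonneg (Φ (betaGen β ^ (n + k) * u) - Φ (betaGen β) ^ k * p), norm_nonneg c]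

/-- Quasi-periodicity: every point `t₀` has, within a bounded distance of any place, a translate
`t₀ + Φ v` whose covering degree does not exceed the one of `t₀`. The translation `v` is divisible
by a high power of `β`, so that the first stages of the tiles are translated exactly, and has so
small a real value that no tile is lost at the boundary of `[0,1)`. -/
lemma exists_encard_le_near (h : IsTilingEmbedding β Φ) (t₀ : W) :
    ∃ R : ℝ, ∀ w : W, ∃ t, ‖t - w‖ ≤ R ∧
      {z : betaRing β | t ∈ ringTile Φ z}.encard ≤ {x : betaRing β | t₀ ∈ ringTile Φ x}.encard := by
  have hβ := zero_lt_one.trans h.one_lt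
  have hF := h.finite_near t₀ (tailBound Φ 0)
  set F := {x : betaRing β | |(x : ℝ)| ≤ 1 ∧ ‖Φ x - t₀‖ ≤ tailBound Φ 0}
  have hlim : Tendsto (fun n : ℕ => tailBound Φ n + 1 / ((n : ℝ) + 1)) atTop (𝓝 0) := by
    simpa using h.tendsto_tailBound.add tendsto_one_div_add_atTop_nhds_zero_nat
  have hn : ∀ᶠ n : ℕ in atTop, ∀ x ∈ F, t₀ ∉ ringTile Φ x →
      ∀ y ∈ ringPreimage β x n, tailBound Φ n + 1 / ((n : ℝ) + 1) ≤ ‖Φ y - t₀‖ := by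
    refine (eventually_all_finite hF).2 fun x _ => ?_
    by_cases hx : t₀ ∈ ringTile Φ x
    · exact Eventually.of_forall fun _ h' => absurd hx h'
    · obtain ⟨ε, hε, he⟩ := h.eventually_le_of_notMem_ringTile hx
      filter_upwards [he, hlim.eventually (gt_mem_nhds hε)] with n h1 h2 _ y hy
      exact h2.le.trans (h1 y hy)
  obtain ⟨n, hn⟩ := hn.exists
  have hη : ∀ᶠ η in 𝓝[>] (0 : ℝ), ∀ x ∈ F, (x : ℝ) < 0 → η ≤ -(x : ℝ) := by
    refine (eventually_all_finite hF).2 fun x _ => ?_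
    by_cases hx : (x : ℝ) < 0
    · filter_upwards [Ioo_mem_nhdsGT (neg_pos.2 hx)] with η hη _ using hη.2.le
    · exact Eventually.of_forall fun _ h' => absurd h' hx
  obtain ⟨η, hη, hη0, hη1⟩ := (hη.and (Ioo_mem_nhdsGT one_pos)).exists
  obtain ⟨R, hR⟩ := h.relatively_dense n η hη0
  refine ⟨R, fun w => ?_⟩
  obtain ⟨v, hv0, hv1, hv⟩ := hR (w - t₀)
  set V := betaGen β ^ n * v with hV
  have hV0 : 0 ≤ (V : ℝ) := by
    rw [hV]; push_cast; rw [coe_betaGen]; positivity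
  refine ⟨t₀ + Φ V, by rwa [show t₀ + Φ V - w = Φ V - (w - t₀) by ring], ?_⟩
  rw [← (sub_left_injective (b := V)).encard_image {z : betaRing β | t₀ + Φ V ∈ ringTile Φ z}]
  refine encard_le_encard ?_
  rintro _ ⟨z, hz : t₀ + Φ V ∈ ringTile Φ z, rfl⟩
  change t₀ ∈ ringTile Φ (z - V)
  have hzu := h.mem_betaUnit_of_mem_ringTile hz
  have hzF : z - V ∈ F := by
    refine ⟨abs_le.2 ⟨?_, ?_⟩, ?_⟩
    · push_cast; linarith [hzu.1]
    · push_cast; linarith [hzu.2]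
    · have := h.norm_sub_le_of_mem_ringTile hz
      rwa [map_sub, show Φ z - Φ V - t₀ = Φ z - (t₀ + Φ V) by ring]
  have hnonneg : 0 ≤ ((z - V : betaRing β) : ℝ) := by
    by_contra hneg
    have := hη _ hzF (not_le.1 hneg)
    push_cast at this
    linarith [hzu.1]
  by_contra hmem
  obtain ⟨_, ⟨u, hu, rfl, rfl⟩, hlt⟩ := h.exists_near_of_mem_ringTile hz n
    (Nat.one_div_pos_of_nat (α := ℝ) (n := n))
  obtain ⟨hm, he⟩ := iterate_betaStep_sub hβ n hu hv0 hnonneg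
  have := hn _ hzF hmem _ ⟨u - v, hm, he, rfl⟩
  rw [mul_sub, map_sub, ← hV, show Φ (betaGen β ^ n * u) - Φ V - t₀ =
    Φ (betaGen β ^ n * u) - (t₀ + Φ V) by ring] at this
  linarith

/-- If some point lies in fewer tiles than `G` has elements, then no point is interior to all tiles
indexed by `G`: blowing up a ball by powers of `β⁻¹` would yield arbitrarily large balls each of
whose points lies in at least as many tiles, contrary to the quasi-periodicity. -/
lemma iInter_interior_eq_empty (h : IsTilingEmbedding β Φ) {t₀ : W} (G : Finset (betaRing β))
    (hG : {x : betaRing β | t₀ ∈ ringTile Φ x}.encard < G.card) :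
    ⋂ x ∈ G, interior (ringTile Φ x) = ∅ := by
  rw [eq_empty_iff_forall_notMem]
  intro t₁ ht₁
  have hopen : IsOpen (⋂ x ∈ G, interior (ringTile Φ x)) :=
    isOpen_biInter_finset fun x _ => isOpen_interior
  obtain ⟨ε, hε, hball⟩ := Metric.isOpen_iff.1 hopen t₁ ht₁
  obtain ⟨R, hR⟩ := h.exists_encard_le_near t₀
  obtain ⟨k, hk⟩ := ((h.tendsto_pow R).eventually (gt_mem_nhds hε)).exists
  obtain ⟨w, rfl⟩ := h.exists_pow_mul_eq k t₁
  obtain ⟨t, htw, hcard⟩ := hR w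
  have hmem : Φ (betaGen β) ^ k * t ∈ ⋂ x ∈ G, interior (ringTile Φ x) := by
    apply hball
    rw [Metric.mem_ball, dist_eq_norm, ← mul_sub]
    exact (norm_map_pow_mul_le _ _).trans_lt
      ((mul_le_mul_of_nonneg_left htw (by positivity)).trans_lt hk)
  have hsub : (G : Set (betaRing β)) ⊆
      (betaStep β)^[k] '' {z : betaRing β | t ∈ ringTile Φ z} := fun x hx => by
    obtain ⟨z, hz, hzt⟩ := h.exists_mem_ringTile_of_pow_mul k
      (interior_subset (mem_iInter₂.1 hmem x hx))
    exact ⟨z, hzt, hz⟩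
  have := (encard_le_encard hsub).trans ((encard_image_le _ _).trans hcard)
  rw [encard_coe_eq_coe_finsetCard] at this
  exact absurd hG (not_lt.2 this)

/-- If all orbits in `ℤ[β] ∩ [0,1)` end in `0`, then the origin lies in no tile but `S_β(0)`:
subdividing a tile that contains the origin shows that its index is the `n`-th iterate of one of
finitely many points, for every `n`. -/
lemma eq_zero_of_zero_mem_ringTile (h : IsTilingEmbedding β Φ)
    (hfin : ∀ u ∈ betaUnit β, ∃ n, (betaStep β)^[n] u = 0) {x : betaRing β}
    (hx : 0 ∈ ringTile Φ x) : x = 0 := by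
  have h0 : Function.IsFixedPt (betaStep β) 0 := by
    simp [Function.IsFixedPt, betaStep]
  have hN : ∀ᶠ n in atTop, ∀ z ∈ {z : betaRing β | 0 ∈ ringTile Φ z}, (betaStep β)^[n] z = 0 := by
    refine (eventually_all_finite (h.finite_containing 0)).2 fun z hz => ?_
    obtain ⟨m, hm⟩ := hfin z (h.mem_betaUnit_of_mem_ringTile hz)
    filter_upwards [eventually_ge_atTop m] with n hn
    rw [← Nat.sub_add_cancel hn, Function.iterate_add_apply, hm]
    exact h0.iterate _
  obtain ⟨N, hN⟩ := hN.exists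
  obtain ⟨z, rfl, hz⟩ := h.exists_mem_ringTile_of_pow_mul N (p := 0) (by simpa using hx)
  exact hN z hz

lemma coveringDegree_eq (h : IsTilingEmbedding β Φ) (t : W) :
    coveringDegree (fun x : betaUnit β => ringTile Φ x) t =
      {x : betaRing β | t ∈ ringTile Φ x}.encard := by
  rw [coveringDegree, ← Subtype.val_injective.encard_image]
  congr 1
  ext x
  constructor
  · rintro ⟨y, hy, rfl⟩
    exact hy
  · exact fun hx => ⟨⟨x, h.mem_betaUnit_of_mem_ringTile hx⟩, hx, rfl⟩

lemma one_le_encard (h : IsTilingEmbedding β Φ) (t : W) :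
    1 ≤ {x : betaRing β | t ∈ ringTile Φ x}.encard :=
  one_le_encard_iff_nonempty.2 (h.exists_mem_ringTile_cover t)

/-- The tiles form a weak `m`-tiling, where `m` is the least covering degree. -/
lemma isWeakMTiling [ProperSpace W] (h : IsTilingEmbedding β Φ) {m : ℕ}
    (hm : IsLeast (range (coveringDegree fun x : betaUnit β => ringTile Φ x)) (m : ℕ∞)) :
    IsWeakMTiling (fun x : betaUnit β => ringTile Φ x) m where
  isCompact x := h.isCompact_ringTile x
  locallyFinite t ε :=
    Finite.preimage (f := Subtype.val) Subtype.val_injective.injOn (h.finite_meeting_ball t ε)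
  covers := eq_univ_of_forall fun t => by
    obtain ⟨z, hz⟩ := h.exists_mem_ringTile_cover t
    exact mem_iUnion.2 ⟨⟨z, h.mem_betaUnit_of_mem_ringTile hz⟩, hz⟩
  degree := hm
  interiors F hF := by
    obtain ⟨t₀, ht₀⟩ := hm.1
    rw [h.coveringDegree_eq] at ht₀
    have := h.iInter_interior_eq_empty (t₀ := t₀) (F.map (Function.Embedding.subtype _)) (by
      rw [ht₀, Finset.card_map, hF]
      exact_mod_cast Nat.lt_succ_self m)
    rw [← this]
    simp

lemma exists_isWeakMTiling [ProperSpace W] (h : IsTilingEmbedding β Φ) :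
    ∃ m : ℕ, 1 ≤ m ∧ IsWeakMTiling (fun x : betaUnit β => ringTile Φ x) m := by
  set D := coveringDegree fun x : betaUnit β => ringTile Φ x with hD
  have hmem : sInf (range D) ∈ range D := csInf_mem (range_nonempty D)
  obtain ⟨t, ht⟩ := id hmem
  have hfin : sInf (range D) ≠ ⊤ := by
    rw [← ht, hD, h.coveringDegree_eq]
    exact encard_ne_top_iff.2 (h.finite_containing t)
  obtain ⟨m, hm⟩ := ENat.ne_top_iff_exists.1 hfin
  refine ⟨m, ?_, h.isWeakMTiling ⟨hm ▸ hmem, fun a ha => hm ▸ csInf_le' ha⟩⟩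
  have := h.one_le_encard t
  rw [← h.coveringDegree_eq, ← hD, ht, ← hm] at this
  exact_mod_cast this

lemma isWeakMTiling_one [ProperSpace W] (h : IsTilingEmbedding β Φ)
    (hfin : ∀ u ∈ betaUnit β, ∃ n, (betaStep β)^[n] u = 0) :
    IsWeakMTiling (fun x : betaUnit β => ringTile Φ x) 1 := by
  refine h.isWeakMTiling ⟨⟨0, ?_⟩, ?_⟩
  · rw [h.coveringDegree_eq, Nat.cast_one]
    refine le_antisymm ?_ (h.one_le_encard 0)
    rw [← encard_singleton (0 : betaRing β)]
    exact encard_le_encard fun x hx => h.eq_zero_of_zero_mem_ringTile hfin hx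
  · rintro _ ⟨t, rfl⟩
    rw [h.coveringDegree_eq, Nat.cast_one]
    exact h.one_le_encard t

end IsTilingEmbedding

/-! ### The conjugate embedding of `ℤ[β]` -/

section Conjugates

open Polynomial

variable {β : ℝ} {r s : ℕ} {ρ : Fin r → (ℚ⟮β⟯ →+* ℝ)} {σ : Fin s → (ℚ⟮β⟯ →+* ℂ)}

/-- The inclusion of `ℤ[β]` into `ℚ(β)`. -/
noncomputable def betaInclusion (β : ℝ) : betaRing β →+* ℚ⟮β⟯ :=
  (Subalgebra.inclusion (Algebra.adjoin_le (by
    rintro _ rfl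
    exact mem_adjoin_simple_self ℚ _) :
      betaRing β ≤ ℚ⟮β⟯.toSubalgebra.restrictScalars ℤ)).toRingHom

@[simp] lemma coe_betaInclusion (u : betaRing β) : ((betaInclusion β u : ℚ⟮β⟯) : ℝ) = u := rfl

lemma betaInclusion_gen : betaInclusion β (betaGen β) = genBeta β := Subtype.ext rfl

/-- The conjugate embedding with values in the normed ring `ℝ ^ r × ℂ ^ s`, where it is a ring
homomorphism. -/
noncomputable def conjHom (ρ : Fin r → (ℚ⟮β⟯ →+* ℝ)) (σ : Fin s → (ℚ⟮β⟯ →+* ℂ)) :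
    betaRing β →+* (Fin r → ℝ) × (Fin s → ℂ) :=
  ((RingHom.pi ρ).prod (RingHom.pi σ)).comp (betaInclusion β)

/-- The Minkowski embedding `x ↦ (x, Φ x)` of `ℤ[β]`. -/
noncomputable def minkowskiHom (ρ : Fin r → (ℚ⟮β⟯ →+* ℝ)) (σ : Fin s → (ℚ⟮β⟯ →+* ℂ)) :
    betaRing β →+* ℝ × (Fin r → ℝ) × (Fin s → ℂ) :=
  (betaRing β).val.toRingHom.prod (conjHom ρ σ)

/-- The complex-valued characters of `ℝ × ℝ ^ r × ℂ ^ s` that correspond to all embeddings of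
`ℚ(β)` into `ℂ`: the identity (`none`), the real ones, and the pairs of complex ones. -/
noncomputable def coordHom (r s : ℕ) :
    Option (Fin r ⊕ Fin s ⊕ Fin s) → (ℝ × (Fin r → ℝ) × (Fin s → ℂ)) →ₐ[ℝ] ℂ
  | none => Complex.ofRealAm.comp (AlgHom.fst ℝ _ _)
  | some (.inl i) => Complex.ofRealAm.comp
      ((Pi.evalAlgHom ℝ _ i).comp ((AlgHom.fst ℝ _ _).comp (AlgHom.snd ℝ _ _)))
  | some (.inr (.inl j)) =>
      (Pi.evalAlgHom ℝ _ j).comp ((AlgHom.snd ℝ _ _).comp (AlgHom.snd ℝ _ _))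
  | some (.inr (.inr j)) => (Complex.conjAe : ℂ →ₐ[ℝ] ℂ).comp
      ((Pi.evalAlgHom ℝ _ j).comp ((AlgHom.snd ℝ _ _).comp (AlgHom.snd ℝ _ _)))

lemma norm_coordHom_le (o : Option (Fin r ⊕ Fin s ⊕ Fin s))
    (p : ℝ × (Fin r → ℝ) × (Fin s → ℂ)) : ‖coordHom r s o p‖ ≤ ‖p‖ := by
  rcases o with _ | i | j | j
  · simpa [coordHom] using norm_fst_le p
  · simpa [coordHom] using (norm_le_pi_norm p.2.1 i).trans ((norm_fst_le p.2).trans (norm_snd_le p))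
  · simpa [coordHom] using (norm_le_pi_norm p.2.2 j).trans ((norm_snd_le p.2).trans (norm_snd_le p))
  · simpa [coordHom] using (norm_le_pi_norm p.2.2 j).trans ((norm_snd_le p.2).trans (norm_snd_le p))

lemma coordHom_minkowskiHom_some (o : Fin r ⊕ Fin s ⊕ Fin s) :
    coordHom r s (some o) (minkowskiHom ρ σ (betaGen β)) =
      Sum.elim (fun i : Fin r => ((ρ i (genBeta β) : ℝ) : ℂ))
        (Sum.elim (fun j : Fin s => σ j (genBeta β))
          (fun j : Fin s => (starRingEnd ℂ) (σ j (genBeta β)))) o := by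
  rcases o with i | j | j <;> simp [coordHom, minkowskiHom, conjHom, betaInclusion_gen]

lemma coordHom_minkowskiHom_none (x : betaRing β) :
    coordHom r s none (minkowskiHom ρ σ x) = ((x : ℝ) : ℂ) := by
  simp [coordHom, minkowskiHom]

lemma IsConjugateSystem.injective (hconj : IsConjugateSystem β ρ σ) :
    Function.Injective fun o => coordHom r s o (minkowskiHom ρ σ (betaGen β)) := by
  have hne : ∀ o, coordHom r s (some o) (minkowskiHom ρ σ (betaGen β)) ≠ (β : ℂ) := fun o => by
    rw [coordHom_minkowskiHom_some]
    exact (hconj.bijOn.mapsTo (mem_univ o)).2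
  rintro (_ | o) (_ | o') h
  · rfl
  · exact absurd (h.symm.trans (coordHom_minkowskiHom_none _)) (hne o')
  · exact absurd (h.trans (coordHom_minkowskiHom_none _)) (hne o)
  · simp only [coordHom_minkowskiHom_some] at h
    rw [hconj.bijOn.injOn (mem_univ o) (mem_univ o') h]

lemma IsConjugateSystem.exists_eq (hconj : IsConjugateSystem β ρ σ) {z : ℂ}
    (hz : aeval z (minpoly ℚ β) = 0) :
    ∃ o, coordHom r s o (minkowskiHom ρ σ (betaGen β)) = z := by
  by_cases h : z = β
  · exact ⟨none, by rw [coordHom_minkowskiHom_none, h, coe_betaGen]⟩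
  · obtain ⟨o, -, ho⟩ := hconj.bijOn.surjOn ⟨hz, h⟩
    exact ⟨some o, by rw [coordHom_minkowskiHom_some, ho]⟩

lemma IsConjugateSystem.norm_lt_one (hβ : IsPisot β) (hconj : IsConjugateSystem β ρ σ) :
    ‖conjHom ρ σ (betaGen β)‖ < 1 := by
  have key : ∀ o, ‖coordHom r s (some o) (minkowskiHom ρ σ (betaGen β))‖ < 1 := fun o => by
    rw [coordHom_minkowskiHom_some]
    obtain ⟨h0, h1⟩ := hconj.bijOn.mapsTo (mem_univ o)
    exact hβ.norm_conj_lt_one _ h0 h1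
  rw [Prod.norm_def, max_lt_iff, pi_norm_lt_iff one_pos, pi_norm_lt_iff one_pos]
  exact ⟨fun i => by simpa [coordHom, minkowskiHom] using key (.inl i),
    fun j => by simpa [coordHom, minkowskiHom] using key (.inr (.inl j))⟩

lemma IsPisot.isUnit_conjHom (hβ : IsPisot β) : IsUnit (conjHom ρ σ (betaGen β)) := by
  rw [conjHom, RingHom.comp_apply, betaInclusion_gen]
  refine IsUnit.map _ (isUnit_iff_ne_zero.2 fun h => ?_)
  have h' : β = 0 := congrArg (Subtype.val) h
  linarith [hβ.one_lt]

/-- Elements of `ℤ[β]` of bounded real value and bounded conjugates are finite in number. -/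
lemma IsConjugateSystem.finite_bounded (hβ : IsPisot β) (hconj : IsConjugateSystem β ρ σ) (C : ℝ) :
    {x : betaRing β | |(x : ℝ)| ≤ C ∧ ‖conjHom ρ σ x‖ ≤ C}.Finite := by
  have : FiniteDimensional ℚ ℚ⟮β⟯ :=
    adjoin.finiteDimensional (hβ.isIntegral.tower_top (A := ℚ))
  have : NumberField ℚ⟮β⟯ := ⟨⟩
  refine Finite.of_finite_image (f := betaInclusion β)
    ((NumberField.Embeddings.finite_of_norm_le ℚ⟮β⟯ ℂ C).subset ?_)
    (fun x _ y _ h => Subtype.ext (congrArg (fun z : ℚ⟮β⟯ => (z : ℝ)) h))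
  rintro _ ⟨x, ⟨hx1, hx2⟩, rfl⟩
  refine ⟨?_, fun φ => ?_⟩
  · have hx : IsIntegral ℤ (x : ℝ) :=
      Algebra.adjoin_le (S := integralClosure ℤ ℝ)
        (singleton_subset_iff.2 hβ.isIntegral) x.2
    exact (isIntegral_algHom_iff (ℚ⟮β⟯.val.restrictScalars ℤ) Subtype.val_injective).1 hx
  · have hroot : aeval (φ (genBeta β)) (minpoly ℚ β) = 0 := by
      have h1 : aeval (genBeta β) (minpoly ℚ β) = 0 := by
        rw [← minpoly_gen]; exact minpoly.aeval _ _
      have := congrArg φ.toRatAlgHom h1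
      rwa [map_zero, ← aeval_algHom_apply] at this
    obtain ⟨o, ho⟩ := hconj.exists_eq hroot
    have hφ : φ (betaInclusion β x) = coordHom r s o (minkowskiHom ρ σ x) := by
      have : (φ.comp (betaInclusion β)).toIntAlgHom =
          ((coordHom r s o : _ →+* ℂ).comp (minkowskiHom ρ σ)).toIntAlgHom := by
        refine AlgHom.adjoin_ext ?_
        rintro _ rfl
        exact ho.symm
      exact DFunLike.congr_fun this x
    rw [hφ]
    refine (norm_coordHom_le o _).trans ?_
    exact max_le hx1 hx2

/-- The powers of `β` below the degree are linearly independent in Minkowski space, since a real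
polynomial of such a degree cannot vanish at all conjugates of `β`. -/
lemma IsConjugateSystem.linearIndependent (hconj : IsConjugateSystem β ρ σ) {n : ℕ}
    (hn : n = Fintype.card (Option (Fin r ⊕ Fin s ⊕ Fin s))) :
    LinearIndependent ℝ fun i : Fin n =>
      minkowskiHom ρ σ (betaGen β) ^ (i : ℕ) := by
  rw [Fintype.linearIndependent_iff]
  intro c hc
  set P : ℝ[X] := ∑ i : Fin n, C (c i) * X ^ (i : ℕ) with hP
  have hdeg : P.degree < n := degree_sum_fin_lt c
  have hPz : aeval (minkowskiHom ρ σ (betaGen β)) P = 0 := by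
    rw [hP, map_sum, ← hc]
    refine Finset.sum_congr rfl fun i _ => ?_
    rw [map_mul, aeval_C, map_pow, aeval_X, Algebra.smul_def]
  have hP0 : P.map (algebraMap ℝ ℂ) = 0 := by
    by_contra hne
    refine hne (eq_zero_of_natDegree_lt_card_of_eval_eq_zero _ hconj.injective (fun o => ?_) ?_)
    · rw [eval_map_algebraMap, aeval_algHom_apply, hPz, map_zero]
    · rw [← hn]
      refine (natDegree_lt_iff_degree_lt hne).2 ?_
      rwa [degree_map]
  rw [Polynomial.map_eq_zero] at hP0
  intro i
  have := congrArg (fun Q => Q.coeff (i : ℕ)) hP0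
  simpa [hP, finsetSum_coeff, coeff_C_mul, coeff_X_pow, Fin.val_inj] using this

/-- The Minkowski embedding has relatively dense image. -/
lemma IsConjugateSystem.exists_norm_sub_le (hconj : IsConjugateSystem β ρ σ) :
    ∃ C : ℝ, ∀ p, ∃ v : betaRing β, ‖minkowskiHom ρ σ v - p‖ ≤ C := by
  obtain ⟨n, hn⟩ : ∃ n, n = Fintype.card (Option (Fin r ⊕ Fin s ⊕ Fin s)) := ⟨_, rfl⟩
  have hcard : Fintype.card (Fin n) =
      Module.finrank ℝ (ℝ × (Fin r → ℝ) × (Fin s → ℂ)) := by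
    simp [hn, Module.finrank_prod, Module.finrank_pi_fintype, Complex.finrank_real_complex]
    ring
  have : Nonempty (Fin n) := ⟨⟨0, by simp [hn]⟩⟩
  set B := basisOfLinearIndependentOfCardEqFinrank (hconj.linearIndependent hn) hcard with hB
  have hBi : ∀ i, B i = minkowskiHom ρ σ (betaGen β) ^ (i : ℕ) := fun i => by
    rw [hB, coe_basisOfLinearIndependentOfCardEqFinrank]
  refine ⟨∑ i, ‖B i‖, fun p => ⟨∑ i : Fin n, (⌊B.repr p i⌋ : betaRing β) * betaGen β ^ (i : ℕ), ?_⟩⟩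
  have : minkowskiHom ρ σ (∑ i : Fin n, (⌊B.repr p i⌋ : betaRing β) * betaGen β ^ (i : ℕ)) - p =
      ∑ i, (-Int.fract (B.repr p i)) • B i := by
    nth_rewrite 2 [← B.sum_repr p]
    rw [map_sum, ← Finset.sum_sub_distrib]
    refine Finset.sum_congr rfl fun i _ => ?_
    rw [map_mul, map_intCast, map_pow, ← hBi, Int.fract, neg_sub, sub_smul, Int.cast_smul_eq_zsmul,
      zsmul_eq_mul]
  rw [this]
  refine (norm_sum_le _ _).trans (Finset.sum_le_sum fun i _ => ?_)
  rw [norm_smul, norm_neg, Real.norm_of_nonneg (Int.fract_nonneg _)]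
  exact mul_le_of_le_one_left (norm_nonneg _) (Int.fract_lt_one _).le

/-- If `β` has conjugates other than itself, then it is irrational, so `ℤ[β]` has arbitrarily
small positive elements. -/
lemma IsConjugateSystem.exists_small (hβ : IsPisot β) (hconj : IsConjugateSystem β ρ σ)
    (o : Fin r ⊕ Fin s ⊕ Fin s) {η : ℝ} (hη : 0 < η) :
    ∃ v : betaRing β, 0 < (v : ℝ) ∧ (v : ℝ) < η := by
  have hirr : Irrational β := by
    rintro ⟨q, hq⟩
    obtain ⟨h0, h1⟩ := hconj.bijOn.mapsTo (mem_univ o)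
    have hmin : minpoly ℚ β = X - C q := by
      rw [← hq]; exact minpoly.eq_X_sub_C ℝ q
    rw [hmin, map_sub, aeval_X, aeval_C, sub_eq_zero] at h0
    refine h1 (h0.trans ?_)
    rw [← hq]
    simp
  have hd : Dense (AddSubgroup.closure {β, 1} : Set ℝ) :=
    dense_addSubgroupClosure_pair_iff.2 (by simpa using hirr)
  obtain ⟨v, hv, hmem⟩ := hd.exists_mem_open isOpen_Ioo (nonempty_Ioo.2 hη)
  have hle : AddSubgroup.closure {β, 1} ≤ (betaRing β).toSubring.toAddSubgroup := by
    rw [AddSubgroup.closure_le]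
    rintro x (rfl | rfl)
    · exact (betaGen x).2
    · exact (1 : betaRing β).2
  exact ⟨⟨v, hle hv⟩, hmem⟩

lemma IsConjugateSystem.relatively_dense (hβ : IsPisot β) (hconj : IsConjugateSystem β ρ σ)
    (n : ℕ) {η : ℝ} (hη : 0 < η) :
    ∃ R : ℝ, ∀ w, ∃ v : betaRing β, 0 ≤ (v : ℝ) ∧
      ((betaGen β ^ n * v : betaRing β) : ℝ) < η ∧ ‖conjHom ρ σ (betaGen β ^ n * v) - w‖ ≤ R := by
  have hβ0 : 0 < β ^ n := pow_pos (zero_lt_one.trans hβ.one_lt) n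
  rcases isEmpty_or_nonempty (Fin r ⊕ Fin s ⊕ Fin s) with hemp | ⟨⟨o⟩⟩
  · have : IsEmpty (Fin r) := (isEmpty_sum.1 hemp).1
    have : IsEmpty (Fin s) := (isEmpty_sum.1 (isEmpty_sum.1 hemp).2).1
    refine ⟨0, fun w => ⟨0, by simp, by simpa using hη, ?_⟩⟩
    rw [Subsingleton.elim (conjHom ρ σ (betaGen β ^ n * 0)) w]
    simp
  obtain ⟨e, he0, he1⟩ := hconj.exists_small hβ o (div_pos hη hβ0)
  obtain ⟨C, hC⟩ := hconj.exists_norm_sub_le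
  set Ψ := minkowskiHom ρ σ with hΨ
  obtain ⟨c, hc⟩ : ∃ c, Ψ (betaGen β) ^ n * c = 1 := by
    have : IsUnit (Ψ (betaGen β)) := Prod.isUnit_iff.2
      ⟨isUnit_iff_ne_zero.2 (zero_lt_one.trans hβ.one_lt).ne', hβ.isUnit_conjHom⟩
    exact (this.pow n).exists_right_inv
  set C' := ‖Ψ (betaGen β) ^ n‖ * C with hC'
  -- The lattice yields a point with real value in `[0, 2C']`; subtracting a multiple of the small
  -- element `β ^ n e` brings the real value into `[0, η)` at a bounded cost.
  refine ⟨C' + (2 * C' / (β ^ n * e)) * ‖conjHom ρ σ (betaGen β ^ n * e)‖, fun w => ?_⟩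
  obtain ⟨v, hv⟩ := hC (c * (C', w))
  have hle : ‖Ψ (betaGen β ^ n * v) - (C', w)‖ ≤ C' := by
    have : Ψ (betaGen β ^ n * v) - (C', w) = Ψ (betaGen β) ^ n * (Ψ v - c * (C', w)) := by
      rw [mul_sub, ← mul_assoc, hc, one_mul, map_mul, map_pow]
    rw [this]
    exact (norm_mul_le _ _).trans (mul_le_mul_of_nonneg_left hv (norm_nonneg _))
  have hreal : |β ^ n * (v : ℝ) - C'| ≤ C' := by
    have := (norm_fst_le _).trans hle
    simpa [hΨ, minkowskiHom] using this
  have hconj' : ‖conjHom ρ σ (betaGen β ^ n * v) - w‖ ≤ C' := (norm_snd_le _).trans hle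
  rw [abs_le] at hreal
  have hv0 : 0 ≤ (v : ℝ) := by
    by_contra hneg
    have := mul_neg_of_pos_of_neg hβ0 (not_le.1 hneg)
    linarith
  set j := ⌊(v : ℝ) / e⌋₊ with hj
  have hj1 : (j : ℝ) * e ≤ v := by
    rw [← le_div_iff₀ he0]; exact Nat.floor_le (by positivity)
  have hj2 : (v : ℝ) < (j + 1) * e := by
    rw [← div_lt_iff₀ he0]; exact Nat.lt_floor_add_one _
  refine ⟨v - j * e, ?_, ?_, ?_⟩
  · push_cast; linarith
  · rw [lt_div_iff₀ hβ0] at he1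
    push_cast
    rw [coe_betaGen]
    nlinarith
  · have heq : conjHom ρ σ (betaGen β ^ n * (v - j * e)) - w =
        (conjHom ρ σ (betaGen β ^ n * v) - w) - j • conjHom ρ σ (betaGen β ^ n * e) := by
      rw [nsmul_eq_mul, ← map_natCast (conjHom ρ σ) j, ← map_mul, sub_right_comm, ← map_sub]
      congr 2
      ring
    rw [heq]
    refine (norm_sub_le _ _).trans (add_le_add hconj' (norm_nsmul_le.trans ?_))
    refine mul_le_mul_of_nonneg_right ?_ (norm_nonneg _)
    rw [le_div_iff₀ (by positivity)]
    nlinarith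

/-- The constant coefficient of the minimal polynomial of a Pisot number `β`, which is the product
of the conjugates up to sign, is at most `β` in modulus. -/
lemma IsPisot.abs_coeff_zero_le (hβ : IsPisot β) : |((minpoly ℤ β).coeff 0 : ℝ)| ≤ β := by
  have hmap : minpoly ℚ β = (minpoly ℤ β).map (algebraMap ℤ ℚ) :=
    minpoly.isIntegrallyClosed_eq_field_fractions' ℚ hβ.isIntegral
  have hint : IsIntegral ℚ β := hβ.isIntegral.tower_top
  set P := (minpoly ℚ β).map (algebraMap ℚ ℂ) with hP
  have hmonic : P.Monic := (minpoly.monic hint).map _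
  have hnodup : P.roots.Nodup :=
    nodup_roots (minpoly.irreducible hint).separable.map
  have hβroot : (β : ℂ) ∈ P.roots := by
    rw [mem_roots hmonic.ne_zero, IsRoot, hP, eval_map_algebraMap]
    have := congrArg (Complex.ofRealAm.restrictScalars ℚ) (minpoly.aeval ℚ β)
    rwa [map_zero, ← aeval_algHom_apply] at this
  have hcoeff := (IsAlgClosed.splits P).coeff_zero_eq_prod_roots_of_monic hmonic
  have hnorm : |((minpoly ℤ β).coeff 0 : ℝ)| = ‖P.coeff 0‖ := by
    rw [hP, hmap, coeff_map, coeff_map]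
    simp [← Real.norm_eq_abs]
  have hrest : ‖(P.roots.erase (β : ℂ)).prod‖ ≤ 1 := by
    refine Multiset.prod_induction (fun z : ℂ => ‖z‖ ≤ 1) _ (fun a b ha hb => ?_) (by simp)
      fun z hz => ?_
    · rw [norm_mul]
      exact mul_le_one₀ ha (norm_nonneg b) hb
    · obtain ⟨hne, hz⟩ := (hnodup.mem_erase_iff).1 hz
      refine (hβ.norm_conj_lt_one z ?_ hne).le
      rwa [mem_roots hmonic.ne_zero, IsRoot, hP, eval_map_algebraMap] at hz
  rw [hnorm, hcoeff, norm_mul, norm_pow, norm_neg, norm_one, one_pow, one_mul,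
    ← Multiset.cons_erase hβroot, Multiset.prod_cons, norm_mul, Complex.norm_real,
    Real.norm_of_nonneg (zero_lt_one.trans hβ.one_lt).le]
  exact mul_le_of_le_one_right (zero_lt_one.trans hβ.one_lt).le hrest

/-- Modulo `β` each element of `ℤ[β]` is congruent to an integer `b` with `0 ≤ b < N`, where `N` is
the modulus of the constant coefficient of the minimal polynomial; as `N ≤ β`, such a digit `b`
leads to a preimage under the `β`-transformation. -/
lemma IsPisot.exists_preimage (hβ : IsPisot β) {u : betaRing β} (hu : u ∈ betaUnit β) :
    ∃ u' ∈ betaUnit β, betaStep β u' = u := by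
  have hβ0 := zero_lt_one.trans hβ.one_lt
  have hdvd : ∀ p : ℤ[X], betaGen β ∣ aeval (betaGen β) p - (p.coeff 0 : betaRing β) := fun p => by
    have h1 : (X : ℤ[X]) ∣ p - C (p.coeff 0) := X_dvd_sub_C
    have := map_dvd (aeval (betaGen β)) h1
    simpa using this
  set a := (minpoly ℤ β).coeff 0 with ha
  have ha0 : a ≠ 0 := fun h => by
    refine minpoly.coeff_zero_ne_zero (A := ℚ) hβ.isIntegral.tower_top hβ0.ne' ?_
    rw [minpoly.isIntegrallyClosed_eq_field_fractions' ℚ hβ.isIntegral, coeff_map, ← ha, h,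
      map_zero]
  have hadvd : betaGen β ∣ (a : betaRing β) := by
    have h1 : aeval (betaGen β) (minpoly ℤ β) = 0 := by
      apply Subtype.val_injective
      have : (betaRing β).val (aeval (betaGen β) (minpoly ℤ β)) = 0 := by
        rw [← aeval_algHom_apply]; exact minpoly.aeval ℤ β
      exact this
    have := hdvd (minpoly ℤ β)
    rwa [h1, zero_sub, dvd_neg] at this
  obtain ⟨p, hp⟩ : ∃ p : ℤ[X], aeval (betaGen β) p = u := by
    have h1 : (u : ℝ) ∈ Algebra.adjoin ℤ {β} := u.2
    rw [Algebra.adjoin_singleton_eq_range_aeval] at h1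
    obtain ⟨p, hp⟩ := h1
    refine ⟨p, Subtype.val_injective ?_⟩
    have : (betaRing β).val (aeval (betaGen β) p) = u := by
      rw [← aeval_algHom_apply]; exact hp
    exact this
  set b : ℤ := (-p.coeff 0) % a with hb
  have hb0 : 0 ≤ b := Int.emod_nonneg _ ha0
  have hb1 : (b : ℝ) + 1 ≤ β := by
    have h1 : b + 1 ≤ |a| := Int.add_one_le_iff.2 (Int.emod_lt_abs _ ha0)
    have h2 : (b : ℝ) + 1 ≤ |(a : ℝ)| := by exact_mod_cast h1
    exact h2.trans hβ.abs_coeff_zero_le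
  obtain ⟨u', hu'⟩ : betaGen β ∣ u + (b : betaRing β) := by
    have h1 : u + (b : betaRing β) =
        (u - (p.coeff 0 : betaRing β)) -
          (a : betaRing β) * ((-p.coeff 0 / a : ℤ) : betaRing β) := by
      have : b = -p.coeff 0 - a * (-p.coeff 0 / a) := Int.emod_def _ _
      rw [this]
      push_cast
      ring
    rw [h1]
    exact dvd_sub (hp ▸ hdvd p) (hadvd.mul_right _)
  have hreal : (u : ℝ) + b = β * u' := by simpa using congrArg (Subtype.val) hu'
  have hb0' : (0 : ℝ) ≤ b := by exact_mod_cast hb0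
  refine ⟨u', ⟨?_, ?_⟩, betaStep_eq_of_mul_eq hu hu'.symm⟩
  · refine nonneg_of_mul_nonneg_right ?_ hβ0
    linarith [hu.1]
  · refine lt_of_mul_lt_mul_left ?_ hβ0.le
    linarith [hu.2]

lemma IsConjugateSystem.isTilingEmbedding (hβ : IsPisot β) (hconj : IsConjugateSystem β ρ σ) :
    IsTilingEmbedding β (conjHom ρ σ) where
  one_lt := hβ.one_lt
  norm_lt_one := hconj.norm_lt_one hβ
  isUnit := hβ.isUnit_conjHom
  finite_bounded := hconj.finite_bounded hβ
  exists_preimage _ hu := hβ.exists_preimage hu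
  relatively_dense n _ hη := hconj.relatively_dense hβ n hη

end Conjugates

/-! ### Transfer to Euclidean space -/

section Transfer

variable {β : ℝ} {r s : ℕ}

lemma lowerLimit_preimage {X Y : Type*} [TopologicalSpace X] [TopologicalSpace Y] (e : X ≃ₜ Y)
    (A : ℕ → Set Y) : lowerLimit (fun n => e ⁻¹' A n) = e ⁻¹' lowerLimit A := by
  ext t
  refine ⟨fun h U hU => ?_, fun h U hU => ?_⟩
  · filter_upwards [h _ (e.continuous.continuousAt hU)] with n hn
    obtain ⟨x, hx, hxU⟩ := hn
    exact ⟨e x, hx, hxU⟩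
  · have hV : e.symm ⁻¹' U ∈ 𝓝 (e t) :=
      e.symm.continuous.continuousAt (by rwa [e.symm_apply_apply])
    filter_upwards [h _ hV] with n hn
    obtain ⟨y, hy, hyU⟩ := hn
    exact ⟨e.symm y, by simpa using hy, hyU⟩

/-- Weak tilings are preserved by linear isomorphisms and by reindexing. -/
lemma IsWeakMTiling.preimage {ι κ V W : Type*} [NormedAddCommGroup V] [NormedSpace ℝ V]
    [NormedAddCommGroup W] [NormedSpace ℝ W] {K : κ → Set W} {m : ℕ} (hK : IsWeakMTiling K m)
    (e : V ≃L[ℝ] W) (f : ι ≃ κ) : IsWeakMTiling (fun i => e ⁻¹' K (f i)) m := by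
  have hdeg : ∀ t, coveringDegree (fun i => e ⁻¹' K (f i)) t = coveringDegree K (e t) := fun t => by
    rw [coveringDegree, coveringDegree, ← f.injective.encard_image]
    congr 1
    ext k
    constructor
    · rintro ⟨i, hi, rfl⟩
      exact hi
    · exact fun hk => ⟨f.symm k, by simpa using hk, by simp⟩
  refine ⟨fun i => ?_, fun t ε => ?_, ?_, ?_, fun F hF => ?_⟩
  · exact e.toHomeomorph.isCompact_preimage.2 (hK.isCompact (f i))
  · obtain ⟨R, hR⟩ := (Metric.isBounded_ball.image
      (e : V →L[ℝ] W) : Bornology.IsBounded ((e : V →L[ℝ] W) '' Metric.ball t ε)).subset_ball 0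
    refine ((hK.locallyFinite 0 R).preimage f.injective.injOn).subset ?_
    rintro i ⟨v, hv, hvb⟩
    exact ⟨e v, hv, hR ⟨v, hvb, rfl⟩⟩
  · refine eq_univ_of_forall fun t => ?_
    obtain ⟨k, hk⟩ := mem_iUnion.1 (hK.covers.symm ▸ mem_univ (e t))
    exact mem_iUnion.2 ⟨f.symm k, by simpa using hk⟩
  · have : range (coveringDegree fun i => e ⁻¹' K (f i)) = range (coveringDegree K) := by
      rw [funext hdeg]
      exact e.surjective.range_comp (coveringDegree K)
    rw [this]
    exact hK.degree
  · have h := hK.interiors (F.map f.toEmbedding) (by rw [Finset.card_map, hF])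
    rw [eq_empty_iff_forall_notMem] at h ⊢
    intro t ht
    refine h (e t) ?_
    simp only [mem_iInter, Finset.mem_map_equiv] at ht ⊢
    intro k hk
    have := ht _ hk
    rw [f.apply_symm_apply] at this
    change t ∈ e.toHomeomorph ⁻¹' interior (K k)
    rwa [e.toHomeomorph.preimage_interior]

/-- The identification of `ℝ ^ (r + 2 s)` with `ℝ ^ r × ℂ ^ s`. -/
noncomputable def conjSpaceEquiv (r s : ℕ) : ConjSpace r s ≃L[ℝ] (Fin r → ℝ) × (Fin s → ℂ) :=
  LinearEquiv.toContinuousLinearEquiv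
    { toFun := fun v => (fun i => v (.inl i), fun j => ⟨v (.inr (j, 0)), v (.inr (j, 1))⟩)
      invFun := fun w => WithLp.toLp 2
        (Sum.elim (fun i => w.1 i) (fun p => ![(w.2 p.1).re, (w.2 p.1).im] p.2))
      map_add' := fun v w => Prod.ext (funext fun i => by simp)
        (funext fun j => Complex.ext (by simp) (by simp))
      map_smul' := fun c v => Prod.ext (funext fun i => by simp)
        (funext fun j => Complex.ext (by simp) (by simp))
      left_inv := fun v => by
        ext (i | ⟨j, k⟩)
        · simp
        · fin_cases k <;> simp
      right_inv := fun w => by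
        ext <;> simp }

variable {ρ : Fin r → (ℚ⟮β⟯ →+* ℝ)} {σ : Fin s → (ℚ⟮β⟯ →+* ℂ)}

lemma conjSpaceEquiv_conjEmbedding (u : betaRing β) :
    conjSpaceEquiv r s (conjEmbedding ρ σ (betaInclusion β u)) = conjHom ρ σ u := by
  ext <;> simp [conjSpaceEquiv, conjEmbedding, conjHom]

lemma scaledPreimage_eq (x : betaRing β) (n : ℕ) :
    scaledPreimage β x n = betaInclusion β '' ringPreimage β x n := by
  ext y
  constructor
  · rintro ⟨u, ⟨huA, hu⟩, hux, hy⟩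
    refine ⟨betaGen β ^ n * ⟨u, huA⟩, ⟨⟨u, huA⟩, hu, Subtype.ext ?_, rfl⟩, Subtype.ext ?_⟩
    · rwa [coe_iterate_betaStep]
    · rw [hy]; rfl
  · rintro ⟨_, ⟨u, hu, rfl, rfl⟩, rfl⟩
    exact ⟨u, ⟨u.2, hu⟩, (coe_iterate_betaStep n u).symm, rfl⟩

lemma integralBetaTile_eq (x : betaRing β) :
    integralBetaTile ρ σ (x : ℝ) = conjSpaceEquiv r s ⁻¹' ringTile (conjHom ρ σ) x := by
  have := lowerLimit_preimage (conjSpaceEquiv r s).toHomeomorph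
    (fun n => conjHom ρ σ '' ringPreimage β x n)
  refine Eq.trans ?_ this
  rw [integralBetaTile]
  congr 1
  funext n
  rw [scaledPreimage_eq, image_image]
  ext v
  constructor
  · rintro ⟨y, hy, rfl⟩
    exact ⟨y, hy, (conjSpaceEquiv_conjEmbedding y).symm⟩
  · rintro ⟨y, hy, hv⟩
    exact ⟨y, hy, (conjSpaceEquiv r s).injective ((conjSpaceEquiv_conjEmbedding y).trans hv)⟩

/-- The index set of the tiles as a subset of `ℝ` and as a subset of `ℤ[β]`. -/
def unitPartEquiv (β : ℝ) : integralUnitPart β ≃ betaUnit β where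
  toFun x := ⟨⟨x, x.2.1⟩, x.2.2⟩
  invFun x := ⟨x, x.1.2, x.2⟩
  left_inv _ := rfl
  right_inv _ := rfl

lemma isWeakMTiling_integralBetaTile {m : ℕ}
    (h : IsWeakMTiling (fun x : betaUnit β => ringTile (conjHom ρ σ) x) m) :
    IsWeakMTiling (fun x : integralUnitPart β => integralBetaTile ρ σ (x : ℝ)) m := by
  have : (fun x : integralUnitPart β => integralBetaTile ρ σ (x : ℝ)) =
      fun x => conjSpaceEquiv r s ⁻¹' ringTile (conjHom ρ σ) (unitPartEquiv β x) :=
    funext fun x => integralBetaTile_eq ⟨x, x.2.1⟩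
  rw [this]
  exact h.preimage (conjSpaceEquiv r s) (unitPartEquiv β)

/-- An integral element of a field lies in the ring generated by its inverse. -/
lemma IsIntegral.mem_adjoin_inv {R K : Type*} [CommRing R] [Field K] [Algebra R K] {x : K}
    (hx : IsIntegral R x) : x ∈ Algebra.adjoin R {x⁻¹} := by
  rcases eq_or_ne x 0 with rfl | hx0
  · exact zero_mem _
  obtain ⟨P, hmonic, hP⟩ := hx
  have hdeg : P.natDegree ≠ 0 := fun h => by
    rw [hmonic.natDegree_eq_zero.1 h, Polynomial.eval₂_one] at hP
    exact one_ne_zero hP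
  obtain ⟨n, hn⟩ := Nat.exists_eq_succ_of_ne_zero hdeg
  -- Divide the equation `P(x) = 0` by `x ^ n`, where `P` has degree `n + 1`.
  have heq : -∑ i ∈ Finset.range (n + 1), P.coeff i • x⁻¹ ^ (n - i) = x := by
    rw [Polynomial.eval₂_eq_sum_range, Finset.sum_range_succ, hn, Nat.succ_eq_add_one] at hP
    have hlead : P.coeff (n + 1) = 1 := by
      rw [← Nat.succ_eq_add_one, ← hn]; exact hmonic.coeff_natDegree
    rw [hlead, map_one, one_mul, pow_succ'] at hP
    have hsum : ∑ i ∈ Finset.range (n + 1), P.coeff i • x⁻¹ ^ (n - i) =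
        x⁻¹ ^ n * ∑ i ∈ Finset.range (n + 1), algebraMap R K (P.coeff i) * x ^ i := by
      rw [Finset.mul_sum]
      refine Finset.sum_congr rfl fun i hi => ?_
      obtain ⟨k, rfl⟩ := Nat.exists_eq_add_of_le (Nat.lt_succ_iff.1 (Finset.mem_range.1 hi))
      rw [Nat.add_sub_cancel_left, Algebra.smul_def, pow_add, inv_pow, inv_pow]
      field_simp
    rw [hsum, eq_neg_of_add_eq_zero_left hP, inv_pow]
    field_simp
  rw [← heq]
  refine neg_mem (sum_mem fun i _ => Subalgebra.smul_mem _ (pow_mem ?_ _) _)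
  rw [heq]
  exact Algebra.subset_adjoin rfl

/-- Since `β` is integral, `ℤ[β]` is contained in `ℤ[β⁻¹]`, so property (F) applies to it. -/
lemma FinitenessProperty.exists_iterate_eq_zero (hF : FinitenessProperty β) (hβ : IsPisot β)
    {u : betaRing β} (hu : u ∈ betaUnit β) : ∃ n, (betaStep β)^[n] u = 0 := by
  have hle : betaRing β ≤ Algebra.adjoin ℤ {β⁻¹} :=
    Algebra.adjoin_le (singleton_subset_iff.2 hβ.isIntegral.mem_adjoin_inv)
  obtain ⟨n, hn⟩ := hF u (hle u.2) hu
  refine ⟨n, Subtype.ext ?_⟩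
  rw [coe_iterate_betaStep, hn, ZeroMemClass.coe_zero]

end Transfer

theorem mainTheorem5 (β : ℝ) (hβ : IsPisot β) {r s : ℕ}
    (ρ : Fin r → (ℚ⟮β⟯ →+* ℝ)) (σ : Fin s → (ℚ⟮β⟯ →+* ℂ))
    (hconj : IsConjugateSystem β ρ σ) :
    (∃ m : ℕ, 1 ≤ m ∧
      IsWeakMTiling (fun x : integralUnitPart β => integralBetaTile ρ σ (x : ℝ)) m) ∧
    (FinitenessProperty β →
      IsWeakMTiling (fun x : integralUnitPart β => integralBetaTile ρ σ (x : ℝ)) 1) := by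
  have h := hconj.isTilingEmbedding hβ
  refine ⟨?_, fun hF => ?_⟩
  · obtain ⟨m, hm, hK⟩ := h.exists_isWeakMTiling
    exact ⟨m, hm, isWeakMTiling_integralBetaTile hK⟩
  · exact isWeakMTiling_integralBetaTile
      (h.isWeakMTiling_one fun u hu => hF.exists_iterate_eq_zero hβ hu)
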